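/- For integers $k_1,\ldots,k_n\ge 1$ with $k_n\ge 2$, let $$\zeta^{\star}(k_1,\ldots,k_n)=\sum_{0<m_1\le\cdots\le m_n}\frac{1}{m_1^{k_1}\cdots m_n^{k_n}}$$ be the multiple zeta-star value, where the $m_j$ are integers. Write $\{2\}^{r}$ for the sequence $2,\ldots,2$ with $r$ entries ($r\ge 0$), and let $\zeta$ be the Riemann zeta function. Then for every integer $s\ge 1$ the series below converge, and $$4s\,(1-2^{-2s})\,\zeta(2s+1)=\zeta^{\star}(3,\{2\}^{s-1})+2\sum_{i=1}^{s}\zeta^{\star}(\{2\}^{i-1},3,\{2\}^{s-i}).$$ -/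

import Mathlib

/-- The index set `0 < m₁ ≤ ⋯ ≤ mₙ` of the series defining a multiple zeta-star value. -/
def StarIndex (n : ℕ) : Type :=
  {m : Fin n → ℕ // (∀ j, 0 < m j) ∧ Monotone m}

/-- The summand `1 / (m₁ ^ k₁ ⋯ mₙ ^ kₙ)`. -/
noncomputable def zetaStarTerm {n : ℕ} (k : Fin n → ℕ) (m : StarIndex n) : ℝ :=
  1 / ∏ j, (m.1 j : ℝ) ^ k j

/-- The multiple zeta-star value
`ζ⋆(k₁, …, kₙ) = ∑_{0 < m₁ ≤ ⋯ ≤ mₙ} 1 / (m₁ ^ k₁ ⋯ mₙ ^ kₙ)`. -/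
noncomputable def zetaStar {n : ℕ} (k : Fin n → ℕ) : ℝ :=
  ∑' m : StarIndex n, zetaStarTerm k m

/-- For `1 ≤ i ≤ s`, the index `(2, …, 2, 3, 2, …, 2)` of length `s`, with the entry `3` in the
`i`-th place counted from `1`, so preceded by `i - 1` and followed by `s - i` entries `2`. -/
def threeAt (s i : ℕ) : Fin s → ℕ :=
  fun j => if (j : ℕ) + 1 = i then 3 else 2

open Filter Topology Finset

/-! The truncations at height `N` have closed forms as single sums. Partial fractions of `∏_{j ≤ N}
(1 - z / j ^ 2)⁻¹` express the truncation of `ζ⋆({2}^s)` through the coefficients `sincCoeff N k`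
(`truncatedZetaStar_two_eq_sum`). The combination containing the 3's has the same shape with the
extra factor `2s / (k + 1) + 2 (H_{N+k+1} - H_N)` (`truncatedSum_eq_sum`); both are proved by
matching recurrences in `N` and `s`. As `N → ∞` the coefficient tends to `2 (-1) ^ k` and the
harmonic gap to 0, so dominated convergence leaves `4s ∑ (-1) ^ k / (k + 1) ^ (2s + 1)`, an
alternating zeta value. -/

/-! ### Truncated zeta-star sums and their limits -/

/-- The sum over the indices of `StarIndex n` all of whose entries are at most `N`. -/
noncomputable def truncatedZetaStar {n : ℕ} (k : Fin n → ℕ) (N : ℕ) : ℝ :=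
  ∑ m ∈ (Fintype.piFinset fun _ : Fin n => Icc 1 N) with Monotone m, 1 / ∏ j, (m j : ℝ) ^ k j

theorem truncatedZetaStar_nonneg {n : ℕ} (k : Fin n → ℕ) (N : ℕ) : 0 ≤ truncatedZetaStar k N :=
  sum_nonneg fun _ _ => by positivity

theorem truncatedZetaStar_length_zero (k : Fin 0 → ℕ) (N : ℕ) : truncatedZetaStar k N = 1 := by
  simp [truncatedZetaStar, Subsingleton.monotone]

theorem truncatedZetaStar_zero {n : ℕ} (k : Fin (n + 1) → ℕ) : truncatedZetaStar k 0 = 0 := by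
  refine sum_eq_zero fun m hm => ?_
  have := Fintype.mem_piFinset.1 (mem_filter.1 hm).1 0
  simp at this

/-- Split according to whether the largest entry is `N + 1`; if it is, deleting it leaves an index
of length `n` still bounded by `N + 1`. -/
theorem truncatedZetaStar_succ {n : ℕ} (k : Fin (n + 1) → ℕ) (N : ℕ) :
    truncatedZetaStar k (N + 1) = truncatedZetaStar k N +
      truncatedZetaStar (fun j => k j.castSucc) (N + 1) / ((N : ℝ) + 1) ^ k (Fin.last n) := by
  rw [truncatedZetaStar, ← sum_filter_add_sum_filter_not _ fun m => m (Fin.last n) ≤ N]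
  congr 1
  · refine sum_congr ?_ fun _ _ => rfl
    ext m
    simp only [mem_filter, Fintype.mem_piFinset, mem_Icc]
    constructor
    · rintro ⟨⟨h, hm⟩, hN⟩
      exact ⟨fun j => ⟨(h j).1, (hm (Fin.le_last j)).trans hN⟩, hm⟩
    · rintro ⟨h, hm⟩
      exact ⟨⟨fun j => ⟨(h j).1, (h j).2.trans N.le_succ⟩, hm⟩, (h _).2⟩
  · rw [truncatedZetaStar, sum_div]
    refine sum_nbij' (fun m j => m j.castSucc)
      (fun m => Fin.snoc (α := fun _ => ℕ) m (N + 1)) ?_ ?_ ?_ ?_ ?_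
    · intro m hm
      simp only [mem_filter, Fintype.mem_piFinset] at hm ⊢
      exact ⟨fun j => hm.1.1 _, fun i j hij => hm.1.2 (by simpa using hij)⟩
    · intro m hm
      simp only [mem_filter, Fintype.mem_piFinset, mem_Icc] at hm ⊢
      refine ⟨⟨fun j => ?_, fun i j hij => ?_⟩, by simp⟩
      · induction j using Fin.lastCases with
        | last => simp
        | cast j => simpa using hm.1 j
      · induction j using Fin.lastCases with
        | last =>
          induction i using Fin.lastCases with
          | last => simp
          | cast i => simpa using (hm.1 i).2
        | cast j =>
          induction i using Fin.lastCases with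
          | last => exact absurd hij (by simp [Fin.le_def])
          | cast i => simpa using hm.2 (by simpa using hij)
    · intro m hm
      simp only [mem_filter, Fintype.mem_piFinset, mem_Icc, not_le] at hm
      have h := (hm.1.1 (Fin.last n)).2
      funext j
      induction j using Fin.lastCases with
      | last => simp; lia
      | cast j => simp
    · intro m _
      funext j
      simp
    · intro m hm
      simp only [mem_filter, Fintype.mem_piFinset, mem_Icc, not_le] at hm
      have h : m (Fin.last n) = N + 1 := by
        have := (hm.1.1 (Fin.last n)).2
        lia
      rw [Fin.prod_univ_castSucc, h, div_div]
      push_cast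
      rfl

/-- The indices of `StarIndex n` all of whose entries are at most `N`. -/
def starIndicesLE (n N : ℕ) : Finset (StarIndex n) :=
  Finset.subtype (fun m : Fin n → ℕ => (∀ j, 0 < m j) ∧ Monotone m)
    (Fintype.piFinset fun _ : Fin n => Icc 1 N)

theorem mem_starIndicesLE {n N : ℕ} {m : StarIndex n} :
    m ∈ starIndicesLE n N ↔ ∀ j, m.1 j ≤ N := by
  refine mem_subtype.trans (Fintype.mem_piFinset.trans (forall_congr' fun j => ?_))
  exact mem_Icc.trans (and_iff_right (m.2.1 j))

theorem sum_zetaStarTerm_eq_truncatedZetaStar {n : ℕ} (k : Fin n → ℕ) (N : ℕ) :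
    ∑ m ∈ starIndicesLE n N, zetaStarTerm k m = truncatedZetaStar k N := by
  rw [truncatedZetaStar]
  refine (sum_subtype_eq_sum_filter (fun m : Fin n → ℕ => 1 / ∏ j, (m j : ℝ) ^ k j)).trans ?_
  refine sum_congr ?_ fun _ _ => rfl
  ext m
  simp only [mem_filter, Fintype.mem_piFinset, mem_Icc]
  exact ⟨fun h => ⟨h.1, h.2.2⟩, fun h => ⟨h.1, fun j => (h.1 j).1, h.2⟩⟩

theorem summable_zetaStarTerm_of_bounded {n : ℕ} {k : Fin n → ℕ} {C : ℝ}
    (h : ∀ N, truncatedZetaStar k N ≤ C) : Summable (zetaStarTerm k) := by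
  refine summable_of_sum_le (fun m => by rw [zetaStarTerm]; positivity) (c := C) fun u => ?_
  obtain ⟨N, hN⟩ : ∃ N, ∀ m ∈ u, ∀ j, m.1 j ≤ N := by
    refine ⟨u.sup fun m => univ.sup m.1, fun m hm j => ?_⟩
    exact (le_sup (f := m.1) (mem_univ j)).trans (le_sup (f := fun m => univ.sup m.1) hm)
  refine le_trans ?_ (h N)
  rw [← sum_zetaStarTerm_eq_truncatedZetaStar]
  refine sum_le_sum_of_subset_of_nonneg (fun m hm => ?_) fun m _ _ => by
    rw [zetaStarTerm]; positivity
  exact mem_starIndicesLE.2 (hN m hm)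

theorem tendsto_truncatedZetaStar {n : ℕ} {k : Fin n → ℕ} (h : Summable (zetaStarTerm k)) :
    Tendsto (truncatedZetaStar k) atTop (𝓝 (zetaStar k)) := by
  have hu : Tendsto (starIndicesLE n) atTop atTop := by
    refine tendsto_atTop_finset_of_monotone (fun M N hMN m hm => ?_) fun m => ?_
    · exact mem_starIndicesLE.2 fun j => (mem_starIndicesLE.1 hm j).trans hMN
    · exact ⟨univ.sup m.1, mem_starIndicesLE.2 fun j => le_sup (f := m.1) (mem_univ j)⟩
  refine (h.hasSum.comp hu).congr fun N => ?_
  exact sum_zetaStarTerm_eq_truncatedZetaStar k N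

/-! ### Partial fraction coefficients and harmonic gaps -/

/-- The coefficient `2 (-1) ^ k N! ^ 2 / ((N - k - 1)! (N + k + 1)!)` of `1 / (1 - z / (k + 1) ^ 2)`
in the partial fraction expansion of `∏_{j = 1}^N (1 - z / j ^ 2)⁻¹`. -/
noncomputable def sincCoeff (N k : ℕ) : ℝ :=
  2 * (-1) ^ k * ∏ j ∈ range (k + 1), ((N : ℝ) - j) / (N + j + 1)

theorem sincCoeff_succ_right (N k : ℕ) :
    sincCoeff N (k + 1) = -sincCoeff N k * (((N : ℝ) - (k + 1)) / (N + k + 2)) := by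
  rw [sincCoeff, prod_range_succ, sincCoeff]
  push_cast
  ring

theorem sincCoeff_eq_zero {N k : ℕ} (h : N ≤ k) : sincCoeff N k = 0 := by
  rw [sincCoeff, prod_eq_zero (mem_range.2 (Nat.lt_succ_of_le h)) (by simp), mul_zero]

/-- Passing from `N + 1` to `N` multiplies the product by `1 - z / (N + 1) ^ 2`, evaluated here at
the pole `z = (k + 1) ^ 2`. -/
theorem sincCoeff_succ_left (N k : ℕ) :
    sincCoeff N k = sincCoeff (N + 1) k * (1 - ((k : ℝ) + 1) ^ 2 / ((N : ℝ) + 1) ^ 2) := by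
  induction k with
  | zero =>
    simp only [sincCoeff, zero_add, prod_range_one]
    push_cast
    field_simp
    ring
  | succ k ih =>
    rw [sincCoeff_succ_right, ih, sincCoeff_succ_right]
    push_cast
    have h1 : (N : ℝ) + k + 2 ≠ 0 := by positivity
    have h2 : (N : ℝ) + 1 + k + 2 ≠ 0 := by positivity
    field_simp
    ring

theorem abs_sincCoeff_le (N k : ℕ) : |sincCoeff N k| ≤ 2 := by
  rcases le_or_gt N k with h | h
  · simp [sincCoeff_eq_zero h]
  · have h0 : ∀ j ∈ range (k + 1), 0 ≤ ((N : ℝ) - j) / (N + j + 1) := fun j hj => by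
      have : (j : ℝ) ≤ N := by exact_mod_cast (show j ≤ N by grind)
      exact div_nonneg (by linarith) (by positivity)
    have h1 : ∏ j ∈ range (k + 1), ((N : ℝ) - j) / (N + j + 1) ≤ 1 :=
      prod_le_one h0 fun j _ => by
        rw [div_le_one (by positivity)]
        linarith [(Nat.cast_nonneg j : (0 : ℝ) ≤ j)]
    rw [sincCoeff, abs_mul, abs_of_nonneg (prod_nonneg h0)]
    simpa [abs_mul] using h1

theorem tendsto_sincCoeff (k : ℕ) :
    Tendsto (fun N => sincCoeff N k) atTop (𝓝 (2 * (-1) ^ k)) := by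
  have h : ∀ j : ℕ, Tendsto (fun N : ℕ => ((N : ℝ) - j) / (N + j + 1)) atTop (𝓝 1) := fun j => by
    have h1 : Tendsto (fun N : ℕ => (1 : ℝ) - (2 * j + 1) / (N + (j + 1))) atTop (𝓝 (1 - 0)) :=
      tendsto_const_nhds.sub (tendsto_const_nhds.div_atTop
        (tendsto_atTop_add_const_right _ _ tendsto_natCast_atTop_atTop))
    rw [sub_zero] at h1
    refine h1.congr fun N => ?_
    field_simp
    ring
  have hp := (tendsto_finsetProd (range (k + 1)) fun j _ => h j).const_mul (2 * (-1 : ℝ) ^ k)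
  rwa [prod_const_one, mul_one] at hp

/-- The difference `H_{N + k} - H_N` of harmonic numbers. -/
noncomputable def harmonicGap (N k : ℕ) : ℝ := ∑ j ∈ range k, 1 / ((N : ℝ) + j + 1)

theorem harmonicGap_nonneg (N k : ℕ) : 0 ≤ harmonicGap N k :=
  sum_nonneg fun _ _ => by positivity

theorem harmonicGap_le (N k : ℕ) : harmonicGap N k ≤ k / ((N : ℝ) + 1) := by
  refine (sum_le_card_nsmul _ _ (1 / ((N : ℝ) + 1)) fun j _ => ?_).trans_eq ?_
  · gcongr
    linarith [(Nat.cast_nonneg j : (0 : ℝ) ≤ j)]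
  · simp [div_eq_mul_inv]

theorem harmonicGap_succ_right (N k : ℕ) :
    harmonicGap N (k + 1) = harmonicGap N k + 1 / ((N : ℝ) + k + 1) := sum_range_succ _ _

theorem harmonicGap_succ_left (N k : ℕ) :
    harmonicGap N k = harmonicGap (N + 1) k + k / (((N : ℝ) + 1) * (N + k + 1)) := by
  induction k with
  | zero => simp [harmonicGap]
  | succ k ih =>
    rw [harmonicGap_succ_right, ih, harmonicGap_succ_right]
    push_cast
    have h1 : (N : ℝ) + k + 1 ≠ 0 := by positivity
    have h2 : (N : ℝ) + 1 + k + 1 ≠ 0 := by positivity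
    have h3 : (N : ℝ) + (k + 1) + 1 ≠ 0 := by positivity
    field_simp
    ring

/-- A discrete antiderivative in `k`, which makes the sum of the coefficients telescope. -/
theorem sincCoeff_eq_sub {N : ℕ} (hN : 0 < N) (k : ℕ) :
    sincCoeff N k = sincCoeff N k * ((N : ℝ) + k + 1) / (2 * N) -
      sincCoeff N (k + 1) * ((N : ℝ) + (k + 1 : ℕ) + 1) / (2 * N) := by
  have : (N : ℝ) ≠ 0 := by positivity
  have : (N : ℝ) + k + 2 ≠ 0 := by positivity
  rw [sincCoeff_succ_right]
  push_cast
  field_simp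
  ring

theorem sum_sincCoeff {N M : ℕ} (hN : 0 < N) (hM : N ≤ M) :
    ∑ k ∈ range M, sincCoeff N k = 1 := by
  rw [sum_congr rfl fun k _ => sincCoeff_eq_sub hN k,
    sum_range_sub' fun k => sincCoeff N k * ((N : ℝ) + k + 1) / (2 * N), sincCoeff_eq_zero hM]
  have : (N : ℝ) ≠ 0 := by positivity
  simp [sincCoeff]
  field_simp

/-- Summation by parts against the same antiderivative. This supplies the `s = 0` input to the
recurrence for `truncatedSum`. -/
theorem sum_sincCoeff_mul_harmonicGap {N M : ℕ} (hN : 0 < N) (hM : N ≤ M) :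
    ∑ k ∈ range M, sincCoeff N k * (2 * harmonicGap N (k + 1)) = 1 / N := by
  have hN' : (N : ℝ) ≠ 0 := by positivity
  have h : ∀ k, sincCoeff N k * (2 * harmonicGap N (k + 1)) =
      sincCoeff N k * (1 / N) + (sincCoeff N k * ((N : ℝ) + k + 1) / N * harmonicGap N k -
      sincCoeff N (k + 1) * ((N : ℝ) + (k + 1 : ℕ) + 1) / N * harmonicGap N (k + 1)) := fun k => by
    have : (N : ℝ) + k + 2 ≠ 0 := by positivity
    have : (N : ℝ) + k + 1 ≠ 0 := by positivity
    rw [sincCoeff_succ_right, harmonicGap_succ_right]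
    push_cast
    field_simp
    ring
  rw [sum_congr rfl fun k _ => h k, sum_add_distrib, ← sum_mul, sum_sincCoeff hN hM,
    sum_range_sub' fun k => sincCoeff N k * ((N : ℝ) + k + 1) / N * harmonicGap N k,
    sincCoeff_eq_zero hM]
  simp [harmonicGap]

/-! ### Closed forms of the truncated sums -/

theorem threeAt_eq_two {s i : ℕ} (h : s < i) : threeAt s i = fun _ => 2 := by
  funext j
  simp [threeAt, show (j : ℕ) + 1 ≠ i by lia]

theorem truncatedZetaStar_two_eq_sum {N M : ℕ} (s : ℕ) (hN : 0 < N) (hM : N ≤ M) :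
    truncatedZetaStar (fun _ : Fin s => 2) N =
      ∑ k ∈ range M, sincCoeff N k / ((k : ℝ) + 1) ^ (2 * s) := by
  induction s generalizing N with
  | zero => simp [truncatedZetaStar_length_zero, sum_sincCoeff hN hM]
  | succ s ih =>
    -- For positive length both sides vanish at `N = 0`, so the induction on `N` can start there.
    -- The range `M` stays fixed throughout.
    clear hN
    induction N with
    | zero => simp [truncatedZetaStar_zero, sincCoeff_eq_zero]
    | succ N ihN =>
      rw [truncatedZetaStar_succ, ihN (by lia), ih N.succ_pos hM, sum_div, ← sum_add_distrib]
      refine sum_congr rfl fun k _ => ?_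
      rw [sincCoeff_succ_left N]
      field_simp
      ring

/-- The truncation of `ζ⋆(3, {2}^{s - 1}) + 2 ∑ ζ⋆({2}^{i - 1}, 3, {2}^{s - i})`. -/
noncomputable def truncatedSum (s N : ℕ) : ℝ :=
  truncatedZetaStar (threeAt s 1) N + 2 * ∑ i ∈ Icc 1 s, truncatedZetaStar (threeAt s i) N

theorem truncatedZetaStar_threeAt_succ {s i : ℕ} (h : i ≤ s) (N : ℕ) :
    truncatedZetaStar (threeAt (s + 1) i) (N + 1) = truncatedZetaStar (threeAt (s + 1) i) N +
      truncatedZetaStar (threeAt s i) (N + 1) / ((N : ℝ) + 1) ^ 2 := by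
  rw [truncatedZetaStar_succ, threeAt, if_neg (by rw [Fin.val_last]; lia)]
  rfl

theorem truncatedZetaStar_threeAt_last_succ (s N : ℕ) :
    truncatedZetaStar (threeAt (s + 1) (s + 1)) (N + 1) =
      truncatedZetaStar (threeAt (s + 1) (s + 1)) N +
      truncatedZetaStar (fun _ : Fin s => 2) (N + 1) / ((N : ℝ) + 1) ^ 3 := by
  rw [truncatedZetaStar_succ, threeAt, if_pos (by rw [Fin.val_last]),
    ← threeAt_eq_two (Nat.lt_succ_self s)]
  rfl

theorem truncatedSum_one_succ (N : ℕ) :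
    truncatedSum 1 (N + 1) = truncatedSum 1 N + 3 / ((N : ℝ) + 1) ^ 3 := by
  simp only [truncatedSum, Icc_self, sum_singleton, truncatedZetaStar_threeAt_last_succ 0,
    truncatedZetaStar_length_zero]
  ring

theorem truncatedSum_succ {s : ℕ} (hs : 1 ≤ s) (N : ℕ) :
    truncatedSum (s + 1) (N + 1) = truncatedSum (s + 1) N +
      truncatedSum s (N + 1) / ((N : ℝ) + 1) ^ 2 +
      2 * truncatedZetaStar (fun _ : Fin s => 2) (N + 1) / ((N : ℝ) + 1) ^ 3 := by
  simp only [truncatedSum, sum_Icc_succ_top (Nat.le_add_left 1 s),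
    truncatedZetaStar_threeAt_last_succ, truncatedZetaStar_threeAt_succ hs]
  rw [sum_congr rfl fun i hi => truncatedZetaStar_threeAt_succ (mem_Icc.1 hi).2 N,
    sum_add_distrib, ← sum_div]
  ring

/-- Holds term by term: the factor `N + k + 2` in the denominator of the harmonic gap's change
cancels against `(N + 1) ^ 2 - (k + 1) ^ 2`. It mirrors `truncatedSum_succ`. -/
theorem sum_sincCoeff_mul_succ {N M : ℕ} (s : ℕ) :
    ∑ k ∈ range M, sincCoeff (N + 1) k / ((k : ℝ) + 1) ^ (2 * (s + 1)) *
        (2 * ((s : ℝ) + 1) / (k + 1) + 2 * harmonicGap (N + 1) (k + 1)) =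
      ∑ k ∈ range M, sincCoeff N k / ((k : ℝ) + 1) ^ (2 * (s + 1)) *
        (2 * ((s : ℝ) + 1) / (k + 1) + 2 * harmonicGap N (k + 1)) +
      (∑ k ∈ range M, sincCoeff (N + 1) k / ((k : ℝ) + 1) ^ (2 * s) *
        (2 * (s : ℝ) / (k + 1) + 2 * harmonicGap (N + 1) (k + 1))) / ((N : ℝ) + 1) ^ 2 +
      2 * (∑ k ∈ range M, sincCoeff (N + 1) k / ((k : ℝ) + 1) ^ (2 * s)) / ((N : ℝ) + 1) ^ 3 := by
  rw [mul_sum, sum_div, sum_div, ← sum_add_distrib, ← sum_add_distrib]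
  refine sum_congr rfl fun k _ => ?_
  rw [sincCoeff_succ_left N, harmonicGap_succ_left N]
  have : (N : ℝ) + (k + 1) + 1 ≠ 0 := by positivity
  push_cast
  field_simp
  ring

theorem truncatedSum_eq_sum {N M s : ℕ} (hs : 1 ≤ s) (hM : N ≤ M) :
    truncatedSum s N = ∑ k ∈ range M, sincCoeff N k / ((k : ℝ) + 1) ^ (2 * s) *
      (2 * (s : ℝ) / (k + 1) + 2 * harmonicGap N (k + 1)) := by
  induction s, hs using Nat.le_induction generalizing N with
  | base =>
    induction N with
    | zero => simp [truncatedSum, truncatedZetaStar_zero, sincCoeff_eq_zero]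
    | succ N ihN =>
      -- At `s = 0` the last two sums are `1 / (N + 1)` and 1, giving the increment `(1 + 2) / (N +
      -- 1) ^ 3`.
      have h := sum_sincCoeff_mul_succ (N := N) (M := M) 0
      simp only [Nat.cast_zero, zero_add, mul_zero, pow_zero, div_one, zero_div,
        sum_sincCoeff N.succ_pos hM, sum_sincCoeff_mul_harmonicGap N.succ_pos hM] at h
      rw [truncatedSum_one_succ, ihN (by lia), Nat.cast_one, h, add_assoc]
      congr 1
      push_cast
      field_simp
      ring
  | succ s hs ih =>
    induction N with
    | zero => simp [truncatedSum, truncatedZetaStar_zero, sincCoeff_eq_zero]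
    | succ N ihN =>
      have h := sum_sincCoeff_mul_succ (N := N) (M := M) s
      rw [truncatedSum_succ hs, ihN (by lia), ih hM, truncatedZetaStar_two_eq_sum s N.succ_pos hM,
        Nat.cast_succ, h]

/-! ### Passage to the limit and the zeta value -/

theorem summable_inv_succ_pow {p : ℕ} (hp : 1 < p) :
    Summable fun k : ℕ => 1 / ((k : ℝ) + 1) ^ p := by
  simpa using (summable_nat_add_iff 1).2 (Real.summable_one_div_nat_pow.2 hp)

theorem tendsto_truncatedSum {s : ℕ} (hs : 1 ≤ s) :
    Tendsto (truncatedSum s) atTop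
      (𝓝 (4 * s * ∑' k : ℕ, (-1) ^ k * (1 / ((k : ℝ) + 1) ^ (2 * s + 1)))) := by
  have h : ∀ N, truncatedSum s N = ∑' k : ℕ, sincCoeff N k / ((k : ℝ) + 1) ^ (2 * s) *
      (2 * (s : ℝ) / (k + 1) + 2 * harmonicGap N (k + 1)) := fun N => by
    rw [truncatedSum_eq_sum hs le_rfl, tsum_eq_sum fun k hk => ?_]
    rw [sincCoeff_eq_zero (by simpa using hk), zero_div, zero_mul]
  simp_rw [funext h, ← tsum_mul_left]
  refine tendsto_tsum_of_dominated_convergence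
    -- The gap is unbounded in `k`, but it is at most 1 for `k < N`, and all other terms vanish. The
    -- constant is `2 * (2s + 2)`.
    (bound := fun k => 4 * (s + 1) * (1 / ((k : ℝ) + 1) ^ 2))
    ((summable_inv_succ_pow one_lt_two).mul_left _) (fun k => ?_) (Eventually.of_forall fun N k => ?_)
  · have hg : Tendsto (fun N => harmonicGap N (k + 1)) atTop (𝓝 0) := by
      refine squeeze_zero (fun N => harmonicGap_nonneg N _) (fun N => harmonicGap_le N _) ?_
      exact tendsto_const_nhds.div_atTop
        (tendsto_atTop_add_const_right _ _ tendsto_natCast_atTop_atTop)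
    convert ((tendsto_sincCoeff k).div_const (((k : ℝ) + 1) ^ (2 * s))).mul
      ((hg.const_mul 2).const_add (2 * (s : ℝ) / (k + 1))) using 2
    field_simp
    ring
  · rcases le_or_gt N k with hk | hk
    · rw [sincCoeff_eq_zero hk]
      simp only [zero_div, zero_mul, norm_zero]
      positivity
    · have hg : harmonicGap N (k + 1) ≤ 1 := by
        refine (harmonicGap_le N _).trans ?_
        rw [div_le_one (by positivity)]
        exact_mod_cast Nat.le_succ_of_le hk
      have hg0 := harmonicGap_nonneg N (k + 1)
      have h1 : 2 * (s : ℝ) / (k + 1) ≤ 2 * s :=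
        div_le_self (by positivity) (by linarith [(Nat.cast_nonneg k : (0 : ℝ) ≤ k)])
      have h2 : ((k : ℝ) + 1) ^ 2 ≤ ((k : ℝ) + 1) ^ (2 * s) :=
        pow_le_pow_right₀ (by linarith [(Nat.cast_nonneg k : (0 : ℝ) ≤ k)]) (by lia)
      have h3 : 0 ≤ 2 * (s : ℝ) / (k + 1) + 2 * harmonicGap N (k + 1) := by positivity
      rw [Real.norm_eq_abs, abs_mul, abs_div, abs_of_nonneg h3,
        abs_of_nonneg (by positivity : 0 ≤ ((k : ℝ) + 1) ^ (2 * s))]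
      calc |sincCoeff N k| / ((k : ℝ) + 1) ^ (2 * s) *
            (2 * (s : ℝ) / (k + 1) + 2 * harmonicGap N (k + 1))
          ≤ 2 / ((k : ℝ) + 1) ^ 2 * (2 * s + 2 * 1) := by
            gcongr
            exact abs_sincCoeff_le N k
        _ = _ := by ring

/-- Negating the terms with `k + 1` even subtracts them twice, and they sum to `2 ^ (-p)` times the
full series. -/
theorem tsum_alternating_inv_pow {p : ℕ} (hp : 1 < p) :
    ∑' k : ℕ, (-1) ^ k * (1 / ((k : ℝ) + 1) ^ p) =
      (1 - 2 / 2 ^ p) * ∑' k : ℕ, 1 / ((k : ℝ) + 1) ^ p := by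
  have hs := summable_inv_succ_pow hp
  have he : Summable fun k : ℕ => 1 / (((2 * k : ℕ) : ℝ) + 1) ^ p :=
    hs.comp_injective (i := fun k : ℕ => 2 * k) fun a b h => by simpa using h
  have ho : Summable fun k : ℕ => 1 / (((2 * k + 1 : ℕ) : ℝ) + 1) ^ p :=
    hs.comp_injective (i := fun k : ℕ => 2 * k + 1) fun a b h => by simpa using h
  have h1 := tsum_even_add_odd (f := fun k : ℕ => 1 / ((k : ℝ) + 1) ^ p) he ho
  have h2 := tsum_even_add_odd (f := fun k : ℕ => (-1) ^ k * (1 / ((k : ℝ) + 1) ^ p))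
    (by simpa [pow_mul] using he) (by simpa [pow_mul, pow_succ] using ho.neg)
  have h3 : ∑' k : ℕ, 1 / (((2 * k + 1 : ℕ) : ℝ) + 1) ^ p =
      1 / 2 ^ p * ∑' k : ℕ, 1 / ((k : ℝ) + 1) ^ p := by
    rw [← tsum_mul_left]
    refine tsum_congr fun k => ?_
    rw [one_div_mul_one_div, ← mul_pow]
    push_cast
    ring_nf
  simp only [pow_mul, pow_add, pow_one, neg_one_sq, one_pow, one_mul, mul_neg, mul_one, neg_mul,
    tsum_neg] at h2
  rw [h3] at h1 h2
  rw [← h2]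
  linear_combination h1

theorem mainTheorem5 (s : ℕ) (hs : 1 ≤ s) :
    (∀ i ∈ Finset.Icc 1 s, Summable (zetaStarTerm (threeAt s i))) ∧
    4 * (s : ℂ) * (1 - (2 : ℂ) ^ (-2 * (s : ℤ))) * riemannZeta (2 * (s : ℂ) + 1) =
      ((zetaStar (threeAt s 1) + 2 * ∑ i ∈ Finset.Icc 1 s, zetaStar (threeAt s i) : ℝ) : ℂ) := by
  have hlim := tendsto_truncatedSum hs
  have hsum : ∀ i ∈ Icc 1 s, Summable (zetaStarTerm (threeAt s i)) := fun i hi => by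
    -- All truncations are nonnegative, so the bounded combination `truncatedSum` dominates each of
    -- them.
    obtain ⟨C, hC⟩ := hlim.bddAbove_range
    refine summable_zetaStarTerm_of_bounded (C := C) fun N => le_trans ?_ (hC ⟨N, rfl⟩)
    have h1 := single_le_sum (f := fun i => truncatedZetaStar (threeAt s i) N)
      (fun i _ => truncatedZetaStar_nonneg _ N) hi
    have h2 := truncatedZetaStar_nonneg (threeAt s i) N
    have h3 := truncatedZetaStar_nonneg (threeAt s 1) N
    simp only [truncatedSum] at h1 ⊢
    linarith
  refine ⟨hsum, ?_⟩
  have hlim' : Tendsto (truncatedSum s) atTop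
      (𝓝 (zetaStar (threeAt s 1) + 2 * ∑ i ∈ Icc 1 s, zetaStar (threeAt s i))) :=
    (tendsto_truncatedZetaStar (hsum 1 (mem_Icc.2 ⟨le_rfl, hs⟩))).add
      ((tendsto_finsetSum _ fun i hi => tendsto_truncatedZetaStar (hsum i hi)).const_mul 2)
  have hzeta : riemannZeta (2 * (s : ℂ) + 1) =
      ((∑' k : ℕ, 1 / ((k : ℝ) + 1) ^ (2 * s + 1) : ℝ) : ℂ) := by
    have h := zeta_eq_tsum_one_div_nat_add_one_cpow (s := ((2 * s + 1 : ℕ) : ℂ))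
      (by rw [Complex.natCast_re]; exact_mod_cast (show 1 < 2 * s + 1 by lia))
    simp only [Complex.cpow_natCast] at h
    push_cast at h ⊢
    exact h
  have hpow : (2 : ℂ) ^ (-2 * (s : ℤ)) = 2 / 2 ^ (2 * s + 1) := by
    rw [neg_mul, zpow_neg, show (2 * (s : ℤ)) = ((2 * s : ℕ) : ℤ) by push_cast; rfl, zpow_natCast,
      pow_succ]
    field_simp
  rw [tendsto_nhds_unique hlim' hlim, tsum_alternating_inv_pow (by lia), hzeta, hpow]
  push_cast
  ring
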